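/- Let $\Sigma$ be a finite alphabet with at least two elements, and equip $\Sigma^\omega$ with the $\sigma$-algebra generated by the cylinder sets and the uniform probability measure $\mathrm{Pr}$, i.e. $\mathrm{Pr}(a_1\cdots a_n\Sigma^\omega)=|\Sigma|^{-n}$ for all $a_1,\dots,a_n\in\Sigma$. Let $\mathcal{U}=(Q,\Sigma,\delta,Q_0,F)$ be a nondeterministic Büchi automaton with finite state set $Q$, transition function $\delta:Q\times\Sigma\to 2^Q$ (extended as usual to $2^Q\times\Sigma^*$, with $\delta(q,z)=\delta(\{q\},z)$), nonempty set $Q_0\subseteq Q$ of initial states and nonempty set $F\subseteq Q$ of accepting states. A run for an infinite word $a_1a_2\cdots$ is a sequence $q_0q_1\cdots$ with $q_0\in Q_0$ and $q_{i+1}\in\delta(q_i,a_{i+1})$ for all $i$; it is accepting if $q_i\in F$ for infinitely many $i$. For $R\subseteq Q$, let $\mathcal{L}_\omega(R)$ be the set of infinite words that have an accepting run in $\mathcal{U}$ with $R$ in place of $Q_0$, and write $\mathcal{L}_\omega(q)=\mathcal{L}_\omega(\{q\})$. Suppose that $\mathcal{U}$ is unambiguous (every infinite word has at most one accepting run) and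 strongly connected (for all $p,q\in Q$ there is $x\in\Sigma^*$ with $q\in\delta(p,x)$). A set $C\subseteq Q$ is a cut if $\mathcal{L}_\omega(p)\cap\mathcal{L}_\omega(q)=\varnothing$ for all $p,q\in C$ with $p\neq q$, and $\mathrm{Pr}(\mathcal{L}_\omega(C))=1$. A cut is pure if it has the form $\delta(q,z)$ for some $q\in Q$ and $z\in\Sigma^*$. Then for all $q\in Q$ and $z\in\Sigma^*$: $\delta(q,z)$ is a cut if and only if $\delta(q,zy)\neq\varnothing$ for every word $y\in\Sigma^*$. Furthermore, if $\mathcal{U}$ is positive, i.e. $\mathrm{Pr}(\mathcal{L}_\omega(Q_0))>0$, then for each cut $C$ the following are equivalent: 1. $C$ is pure; 2. for each state $q\in Q$ there is a word $z\in\Sigma^*$ with $C=\delta(q,z)$; 3. for each cut $C'$ there is a word $y\in\Sigma^*$ with $C=\delta(C',y)$. -/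

import Mathlib

open MeasureTheory

/-- A nondeterministic Büchi automaton `(Q, A, δ, Q₀, F)` has the same data as an `NFA`:
`step` is `δ`, `start` is `Q₀`, `accept` is `F`, and `evalFrom R x` is `δ(R, x)`.
Only the acceptance condition (on infinite words) differs. -/
abbrev NBA (A : Type*) (Q : Type*) := NFA A Q

namespace NBA

variable {A Q : Type*}

/-- The automaton `U[R]`: `U` with `R` as its set of initial states. -/
def withStart (U : NBA A Q) (R : Set Q) : NBA A Q where
  step := U.step
  start := R
  accept := U.accept

/-- `ρ` is a run of `U` for the infinite word `w`; `w i` is the `(i+1)`-st letter. -/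
def IsRun (U : NBA A Q) (w : ℕ → A) (ρ : ℕ → Q) : Prop :=
  ρ 0 ∈ U.start ∧ ∀ i, ρ (i + 1) ∈ U.step (ρ i) (w i)

/-- A run is accepting if it visits `F` infinitely often. -/
def IsAcceptingRun (U : NBA A Q) (w : ℕ → A) (ρ : ℕ → Q) : Prop :=
  U.IsRun w ρ ∧ {i | ρ i ∈ U.accept}.Infinite

/-- The language of infinite words that have an accepting run. -/
def language (U : NBA A Q) : Set (ℕ → A) :=
  {w | ∃ ρ, U.IsAcceptingRun w ρ}

/-- Every infinite word has at most one accepting run. -/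
def IsUnambiguous (U : NBA A Q) : Prop :=
  ∀ w ρ ρ', U.IsAcceptingRun w ρ → U.IsAcceptingRun w ρ' → ρ = ρ'

/-- Every state is reachable from every state. -/
def IsStronglyConnected (U : NBA A Q) : Prop :=
  ∀ p q : Q, ∃ x : List A, q ∈ U.evalFrom {p} x

end NBA

/-- The uniform probability measure on infinite words: all letters are independent and
uniformly distributed, so the cylinder of a word of length `n` has measure `1 / |A| ^ n`. -/
noncomputable def uniformWordMeasure (A : Type*) [Fintype A] [Nonempty A] [MeasurableSpace A] :
    Measure (ℕ → A) :=
  Measure.infinitePi fun _ : ℕ => (PMF.uniformOfFintype A).toMeasure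

namespace NBA

variable {A Q : Type*} [Fintype A] [Nonempty A] [MeasurableSpace A]

/-- `Pr(L(U)) > 0`. -/
def IsPositive (U : NBA A Q) : Prop :=
  0 < uniformWordMeasure A U.language

/-- `Pr(L(U)) = 1`. -/
def IsAlmostUniversal (U : NBA A Q) : Prop :=
  uniformWordMeasure A U.language = 1

/-- The states of `C` have pairwise disjoint languages and `U[C]` is almost universal. -/
def IsCut (U : NBA A Q) (C : Set Q) : Prop :=
  (∀ p ∈ C, ∀ q ∈ C, p ≠ q →
    (U.withStart {q}).language ∩ (U.withStart {p}).language = ∅) ∧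
  (U.withStart C).IsAlmostUniversal

/-- A cut of the form `δ(q, z)`. -/
def IsPureCut (U : NBA A Q) (C : Set Q) : Prop :=
  U.IsCut C ∧ ∃ (q : Q) (z : List A), C = U.evalFrom {q} z

end NBA

/-!
Two states of an unambiguous set `R` have no common successor under a letter, since every state
has a nonempty language. Hence the powers of the transition matrix `M`, averaged over all letters,
have entries at most `1`. Deleting the transitions into `F` gives a matrix `M'` strictly below the
irreducible matrix `M`, and the probabilities `v` of having a run that avoids `F` satisfy
`v ≤ M' v`; a Perron–Frobenius argument then forces `v = 0`. If no finite word kills `R`, then every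
infinite word has a run from `R` by König's lemma, so almost every word has an accepting one.

Conversely, the probability of `L(R)` is at most the average of those of `L(δ(R, a))`. So once it is
maximal among the sets `δ(R, x)`, it is constant on them, and if it is positive none of them is
empty. Cuts are therefore the unambiguous sets that no word kills. Any two of these accept a common
word, which makes cuts maximal among the unambiguous sets, and the three descriptions of pure cuts
follow by comparing `C` with a set that contains it.
-/

open Filter Finset Matrix ProbabilityTheory Topology

section NonnegativeMatrix

variable {n : Type*} [Fintype n] {M M' : Matrix n n ℝ} {v w : n → ℝ}

lemma mulVec_le_mulVec_of_nonneg (hM : ∀ i j, 0 ≤ M i j) (h : v ≤ w) : M *ᵥ v ≤ M *ᵥ w :=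
  fun i ↦ dotProduct_le_dotProduct_of_nonneg_left h (hM i)

lemma mul_le_mulVec_apply (hM : ∀ i j, 0 ≤ M i j) (hv : 0 ≤ v) (i j : n) :
    M i j * v j ≤ (M *ᵥ v) i :=
  single_le_sum (f := fun k ↦ M i k * v k) (fun k _ ↦ mul_nonneg (hM i k) (hv k)) (mem_univ j)

section Powers

variable [DecidableEq n]

lemma sum_range_pow_mulVec_sub (M : Matrix n n ℝ) (v : n → ℝ) (N : ℕ) :
    ∑ k ∈ range N, M ^ k *ᵥ (M *ᵥ v - v) = M ^ N *ᵥ v - v := by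
  simp only [mulVec_sub, mulVec_mulVec, ← pow_succ]
  rw [sum_range_sub fun k ↦ M ^ k *ᵥ v, pow_zero, one_mulVec]

lemma le_pow_mulVec (hM : ∀ i j, 0 ≤ M i j) (h : v ≤ M *ᵥ v) (k : ℕ) : v ≤ M ^ k *ᵥ v := by
  induction k with
  | zero => simp
  | succ k ih =>
    rw [pow_succ, ← mulVec_mulVec]
    exact ih.trans (mulVec_le_mulVec_of_nonneg (pow_apply_nonneg hM k) h)

lemma pow_mulVec_eq (h : M *ᵥ v = v) (k : ℕ) : M ^ k *ᵥ v = v := by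
  induction k with
  | zero => simp
  | succ k ih => rw [pow_succ, ← mulVec_mulVec, h, ih]

lemma exists_pow_apply_pos (hM : M.IsIrreducible) (i j : n) : ∃ k, 0 < (M ^ k) i j :=
  let ⟨k, _, hk⟩ := (isIrreducible_iff_exists_pow_pos hM.nonneg).1 hM i j
  ⟨k, hk⟩

lemma tendsto_pow_apply_zero_of_isIrreducible (hM : M.IsIrreducible) {i j : n}
    (h : Tendsto (fun k ↦ (M ^ k) i j) atTop (𝓝 0)) (l : n) :
    Tendsto (fun k ↦ (M ^ k) i l) atTop (𝓝 0) := by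
  have hpow := pow_apply_nonneg hM.nonneg
  obtain ⟨m, hm⟩ := exists_pow_apply_pos hM l j
  have hlim : Tendsto (fun k ↦ (M ^ (k + m)) i j / (M ^ m) l j) atTop (𝓝 0) := by
    simpa using ((tendsto_add_atTop_iff_nat m).2 h).div_const ((M ^ m) l j)
  refine squeeze_zero (fun k ↦ hpow k i l) (fun k ↦ ?_) hlim
  rw [le_div_iff₀ hm, pow_add]
  exact mul_le_mulVec_apply (v := fun r ↦ (M ^ m) r j) (hpow k) (fun r ↦ hpow m r j) i l

lemma tendsto_pow_apply_zero_of_lt_mulVec {K : ℝ} (hM : ∀ i j, 0 ≤ M i j)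
    (hK : ∀ k i j, (M ^ k) i j ≤ K) (hv : 0 ≤ v) (hle : v ≤ M *ᵥ v) {j : n}
    (hlt : v j < (M *ᵥ v) j) (i : n) : Tendsto (fun k ↦ (M ^ k) i j) atTop (𝓝 0) := by
  have hpow := pow_apply_nonneg hM
  have hgap : 0 < (M *ᵥ v - v) j := sub_pos.2 hlt
  have hsum : Summable fun k ↦ (M ^ k) i j * (M *ᵥ v - v) j := by
    refine summable_of_sum_range_le (c := ∑ l, K * v l)
      (fun k ↦ mul_nonneg (hpow k i j) hgap.le) fun N ↦ ?_
    calc ∑ k ∈ range N, (M ^ k) i j * (M *ᵥ v - v) j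
        ≤ ∑ k ∈ range N, (M ^ k *ᵥ (M *ᵥ v - v)) i :=
          sum_le_sum fun k _ ↦ mul_le_mulVec_apply (hpow k) (sub_nonneg.2 hle) i j
      _ = (M ^ N *ᵥ v) i - v i := by
          rw [← Finset.sum_apply, sum_range_pow_mulVec_sub, Pi.sub_apply]
      _ ≤ (M ^ N *ᵥ v) i := sub_le_self _ (hv i)
      _ ≤ ∑ l, K * v l := sum_le_sum fun l _ ↦ mul_le_mul_of_nonneg_right (hK N i l) (hv l)
  simpa only [mul_div_cancel_right₀ _ hgap.ne', zero_div] using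
    hsum.tendsto_atTop_zero.div_const ((M *ᵥ v - v) j)

lemma mulVec_eq_of_le_mulVec {K : ℝ} (hM : M.IsIrreducible) (hK : ∀ k i j, (M ^ k) i j ≤ K)
    (hv : 0 ≤ v) (hle : v ≤ M *ᵥ v) : M *ᵥ v = v := by
  by_contra hne
  obtain ⟨j, hj⟩ := Function.ne_iff.1 hne
  have hzero (i l : n) : Tendsto (fun k ↦ (M ^ k) i l) atTop (𝓝 0) :=
    tendsto_pow_apply_zero_of_isIrreducible hM (tendsto_pow_apply_zero_of_lt_mulVec hM.nonneg hK
      hv hle (lt_of_le_of_ne (hle j) hj.symm) i) l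
  have hv0 : v = 0 := by
    refine le_antisymm (fun i ↦ ?_) hv
    have hlim : Tendsto (fun k ↦ (M ^ k *ᵥ v) i) atTop (𝓝 (∑ l, 0 * v l)) :=
      tendsto_finsetSum _ fun l _ ↦ (hzero i l).mul_const (v l)
    simp only [zero_mul, sum_const_zero] at hlim
    exact ge_of_tendsto' hlim fun k ↦ le_pow_mulVec hM.nonneg hle k i
  exact hne (by rw [hv0, mulVec_zero])

end Powers

lemma eq_zero_of_mulVec_eq_of_apply_eq_zero (hM : M.IsIrreducible) (hv : 0 ≤ v)
    (hfix : M *ᵥ v = v) {i : n} (hi : v i = 0) : v = 0 := by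
  classical
  funext j
  obtain ⟨k, hk⟩ := exists_pow_apply_pos hM i j
  have h := mul_le_mulVec_apply (pow_apply_nonneg hM.nonneg k) hv i j
  rw [pow_mulVec_eq hfix, hi] at h
  exact le_antisymm (nonpos_of_mul_nonpos_right h hk) (hv j)

lemma eq_zero_of_le_mulVec_of_lt [DecidableEq n] {K : ℝ} (hM : M.IsIrreducible)
    (hK : ∀ k i j, (M ^ k) i j ≤ K) (hle : ∀ i j, M' i j ≤ M i j) {i j : n} (hlt : M' i j < M i j)
    (hv : 0 ≤ v) (hsub : v ≤ M' *ᵥ v) : v = 0 := by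
  have hM'v : M' *ᵥ v ≤ M *ᵥ v := fun k ↦ dotProduct_le_dotProduct_of_nonneg_right (hle k) hv
  have hfix : M *ᵥ v = v := mulVec_eq_of_le_mulVec hM hK hv (hsub.trans hM'v)
  refine eq_zero_of_mulVec_eq_of_apply_eq_zero hM hv hfix (i := j) ?_
  by_contra hj
  have hstrict : (M' *ᵥ v) i < (M *ᵥ v) i :=
    sum_lt_sum (fun l _ ↦ mul_le_mul_of_nonneg_right (hle i l) (hv l))
      ⟨j, mem_univ j, mul_lt_mul_of_pos_right hlt (lt_of_le_of_ne (hv j) (Ne.symm hj))⟩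
  exact (hsub i).not_gt (hstrict.trans_eq (congrFun hfix i))

end NonnegativeMatrix

section UniformWordMeasure

lemma indepFun_head_tail {Ω : ℕ → Type*} [∀ n, MeasurableSpace (Ω n)]
    (P : ∀ n, Measure (Ω n)) [∀ n, IsProbabilityMeasure (P n)] :
    IndepFun (fun w : ∀ n, Ω n ↦ w 0) (fun w n ↦ w (n + 1)) (Measure.infinitePi P) := by
  have hle (n : ℕ) : MeasurableSpace.comap (fun w : ∀ n, Ω n ↦ w n) inferInstance ≤
      MeasurableSpace.pi := (measurable_pi_apply n).comap_le
  have hindep : iIndepFun (fun n (w : ∀ n, Ω n) ↦ w n) (Measure.infinitePi P) :=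
    iIndepFun_infinitePi fun _ ↦ measurable_id
  have hdisj : Disjoint ({0} : Set ℕ) (Set.Ioi 0) := by simp
  refine indep_of_indep_of_le_left (indep_of_indep_of_le_right
    (indep_iSup_of_disjoint hle hindep.iIndep hdisj) ?_) ?_
  · simp only [MeasurableSpace.pi, MeasurableSpace.comap_iSup, MeasurableSpace.comap_comp]
    exact iSup_le fun n ↦ le_biSup (fun n ↦ MeasurableSpace.comap (fun w : ∀ n, Ω n ↦ w n)
      inferInstance) (Nat.succ_pos n)
  · exact le_biSup (fun n ↦ MeasurableSpace.comap (fun w : ∀ n, Ω n ↦ w n) inferInstance)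
      (Set.mem_singleton 0)

variable {A : Type*} [Fintype A] [Nonempty A] [MeasurableSpace A]

instance : IsProbabilityMeasure (uniformWordMeasure A) := by
  unfold uniformWordMeasure; infer_instance

lemma measurePreserving_drop (m : ℕ) : MeasurePreserving (fun (w : ℕ → A) n ↦ w (n + m))
    (uniformWordMeasure A) (uniformWordMeasure A) :=
  ⟨by fun_prop, Measure.map_infinitePi_infinitePi_of_inj (add_left_injective m)⟩

variable [MeasurableSingletonClass A]

lemma uniformWordMeasure_head_eq_inter_tail_mem_le (a : A) (S : Set (ℕ → A)) :
    uniformWordMeasure A {w | w 0 = a ∧ (fun n ↦ w (n + 1)) ∈ S} ≤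
      (Fintype.card A : ENNReal)⁻¹ * uniformWordMeasure A S := by
  set μ := uniformWordMeasure A
  have hhead : μ ((fun w ↦ w 0) ⁻¹' {a}) = (Fintype.card A : ENNReal)⁻¹ := by
    rw [← PMF.uniformOfFintype_apply a,
      ← PMF.toMeasure_apply_singleton _ a (measurableSet_singleton a)]
    exact (measurePreserving_eval_infinitePi (fun _ ↦ (PMF.uniformOfFintype A).toMeasure)
      0).measure_preimage (measurableSet_singleton a).nullMeasurableSet
  have hT : MeasurableSet (toMeasurable μ S) := measurableSet_toMeasurable μ S
  calc μ {w | w 0 = a ∧ (fun n ↦ w (n + 1)) ∈ S}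
      ≤ μ ((fun w ↦ w 0) ⁻¹' {a} ∩ (fun w n ↦ w (n + 1)) ⁻¹' toMeasurable μ S) :=
        measure_mono fun w hw ↦ ⟨hw.1, subset_toMeasurable μ S hw.2⟩
    _ = μ ((fun w ↦ w 0) ⁻¹' {a}) * μ ((fun w n ↦ w (n + 1)) ⁻¹' toMeasurable μ S) :=
        (indepFun_head_tail _).measure_inter_preimage_eq_mul _ _ (measurableSet_singleton a) hT
    _ = (Fintype.card A : ENNReal)⁻¹ * μ S := by
        rw [hhead, (measurePreserving_drop 1).measure_preimage hT.nullMeasurableSet,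
          measure_toMeasurable]

lemma uniformWordMeasure_real_le_of_tail_mem {S : Set (ℕ → A)} {T : A → Set (ℕ → A)}
    (h : ∀ w ∈ S, (fun n ↦ w (n + 1)) ∈ T (w 0)) :
    (uniformWordMeasure A).real S ≤
      (Fintype.card A : ℝ)⁻¹ * ∑ a, (uniformWordMeasure A).real (T a) := by
  calc (uniformWordMeasure A).real S
      ≤ (uniformWordMeasure A).real (⋃ a, {w | w 0 = a ∧ (fun n ↦ w (n + 1)) ∈ T a}) :=
        measureReal_mono fun w hw ↦ Set.mem_iUnion.2 ⟨w 0, rfl, h w hw⟩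
    _ ≤ ∑ a, (uniformWordMeasure A).real {w | w 0 = a ∧ (fun n ↦ w (n + 1)) ∈ T a} :=
        measureReal_iUnion_fintype_le _
    _ ≤ (Fintype.card A : ℝ)⁻¹ * ∑ a, (uniformWordMeasure A).real (T a) := by
        rw [mul_sum]
        refine sum_le_sum fun a _ ↦ ?_
        have hmul := ENNReal.toReal_mono (ENNReal.mul_ne_top (by simp) (measure_ne_top _ _))
          (uniformWordMeasure_head_eq_inter_tail_mem_le a (T a))
        simpa [Measure.real] using hmul

end UniformWordMeasure

/-- The sequence `a, s 0, s 1, …`: it prepends a letter to an infinite word, and a state to a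
run. -/
def consSeq {α : Type*} (a : α) (s : ℕ → α) : ℕ → α
  | 0 => a
  | n + 1 => s n

lemma infinite_setOf_succ_iff {p : ℕ → Prop} :
    {n | p (n + 1)}.Infinite ↔ {n | p n}.Infinite := by
  rw [← Nat.frequently_atTop_iff_infinite, ← Nat.frequently_atTop_iff_infinite,
    ← frequently_map (m := (· + 1)) (P := p), map_add_atTop_eq_nat]

namespace NBA

section Runs

variable {A Q : Type*} {U : NBA A Q} {R S : Set Q} {w : ℕ → A} {ρ : ℕ → Q}

lemma evalFrom_mono (U : NBA A Q) (h : R ⊆ S) (x : List A) : U.evalFrom R x ⊆ U.evalFrom S x := by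
  rw [U.evalFrom_eq_biUnion_singleton R, U.evalFrom_eq_biUnion_singleton S]
  exact Set.biUnion_subset_biUnion_left h

lemma IsAcceptingRun.withStart (h : (U.withStart R).IsAcceptingRun w ρ) (h0 : ρ 0 ∈ S) :
    (U.withStart S).IsAcceptingRun w ρ :=
  ⟨⟨h0, h.1.2⟩, h.2⟩

lemma isAcceptingRun_iff_tail : (U.withStart R).IsAcceptingRun w ρ ↔ ρ 0 ∈ R ∧
    (U.withStart (U.step (ρ 0) (w 0))).IsAcceptingRun (fun n ↦ w (n + 1)) fun n ↦ ρ (n + 1) := by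
  refine ⟨fun h ↦ ⟨h.1.1, ⟨h.1.2 0, fun n ↦ h.1.2 (n + 1)⟩, infinite_setOf_succ_iff.2 h.2⟩,
    fun ⟨h0, h⟩ ↦ ⟨⟨h0, ?_⟩, infinite_setOf_succ_iff.1 h.2⟩⟩
  rintro (_ | n)
  exacts [h.1.1, h.1.2 n]

lemma IsAcceptingRun.consSeq {q : Q} {a : A}
    (h : (U.withStart (U.step q a)).IsAcceptingRun w ρ) (hq : q ∈ R) :
    (U.withStart R).IsAcceptingRun (consSeq a w) (consSeq q ρ) :=
  isAcceptingRun_iff_tail.2 ⟨hq, h⟩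

lemma language_mono (h : R ⊆ S) : (U.withStart R).language ⊆ (U.withStart S).language :=
  fun _ ⟨ρ, hρ⟩ ↦ ⟨ρ, hρ.withStart (h hρ.1.1)⟩

lemma language_withStart_eq_biUnion (U : NBA A Q) (R : Set Q) :
    (U.withStart R).language = ⋃ q ∈ R, (U.withStart {q}).language := by
  refine subset_antisymm ?_ (Set.iUnion₂_subset fun q hq ↦
    language_mono (Set.singleton_subset_iff.2 hq))
  exact fun w ⟨ρ, hρ⟩ ↦ Set.mem_biUnion hρ.1.1 ⟨ρ, hρ.withStart rfl⟩

lemma mem_language_withStart_iff_tail : w ∈ (U.withStart R).language ↔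
    (fun n ↦ w (n + 1)) ∈ (U.withStart (U.stepSet R (w 0))).language := by
  constructor
  · rintro ⟨ρ, hρ⟩
    obtain ⟨h0, htail⟩ := isAcceptingRun_iff_tail.1 hρ
    exact ⟨_, htail.withStart (NFA.mem_stepSet.2 ⟨ρ 0, h0, htail.1.1⟩)⟩
  · rintro ⟨ρ, hρ⟩
    obtain ⟨q, hq, hstep⟩ := NFA.mem_stepSet.1 hρ.1.1
    exact ⟨consSeq q ρ, isAcceptingRun_iff_tail.2 ⟨hq, hρ.withStart hstep⟩⟩

lemma disjoint_language_evalFrom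
    (h : Disjoint (U.withStart R).language (U.withStart S).language) (x : List A) :
    Disjoint (U.withStart (U.evalFrom R x)).language (U.withStart (U.evalFrom S x)).language := by
  induction x generalizing R S with
  | nil => exact h
  | cons a _ ih =>
    refine ih (Set.disjoint_left.2 fun w hR hS ↦ ?_)
    have hR' : consSeq a w ∈ (U.withStart R).language := mem_language_withStart_iff_tail.2 hR
    exact Set.disjoint_left.1 h hR' (mem_language_withStart_iff_tail.2 hS)

end Runs

section Unambiguous

variable {A Q : Type*} {U : NBA A Q} {R S T : Set Q} {p p' q : Q} {a : A}

lemma IsUnambiguous.mono (h : (U.withStart S).IsUnambiguous) (hRS : R ⊆ S) :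
    (U.withStart R).IsUnambiguous :=
  fun w ρ ρ' hρ hρ' ↦ h w ρ ρ' (hρ.withStart (hRS hρ.1.1)) (hρ'.withStart (hRS hρ'.1.1))

lemma IsUnambiguous.disjoint_language (h : (U.withStart T).IsUnambiguous) (hR : R ⊆ T)
    (hS : S ⊆ T) (hRS : Disjoint R S) :
    Disjoint (U.withStart R).language (U.withStart S).language := by
  refine Set.disjoint_left.2 fun w ⟨ρ, hρ⟩ ⟨ρ', hρ'⟩ ↦ ?_
  have heq : ρ = ρ' := h w ρ ρ' (hρ.withStart (hR hρ.1.1)) (hρ'.withStart (hS hρ'.1.1))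
  exact Set.disjoint_left.1 hRS hρ.1.1 (heq ▸ hρ'.1.1)

lemma IsUnambiguous.stepSet (h : (U.withStart R).IsUnambiguous) (a : A) :
    (U.withStart (U.stepSet R a)).IsUnambiguous := by
  intro w ρ ρ' hρ hρ'
  obtain ⟨q, hq, hstep⟩ := NFA.mem_stepSet.1 hρ.1.1
  obtain ⟨q', hq', hstep'⟩ := NFA.mem_stepSet.1 hρ'.1.1
  have heq := h _ _ _ ((hρ.withStart hstep).consSeq hq) ((hρ'.withStart hstep').consSeq hq')
  exact funext fun n ↦ congrFun heq (n + 1)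

lemma IsUnambiguous.evalFrom (h : (U.withStart R).IsUnambiguous) (x : List A) :
    (U.withStart (U.evalFrom R x)).IsUnambiguous := by
  induction x generalizing R with
  | nil => exact h
  | cons a _ ih => exact ih (h.stepSet a)

lemma IsUnambiguous.withStart_singleton (hU : U.IsUnambiguous) (hsc : U.IsStronglyConnected)
    (hstart : U.start.Nonempty) (q : Q) : (U.withStart {q}).IsUnambiguous := by
  obtain ⟨s, hs⟩ := hstart
  obtain ⟨x, hx⟩ := hsc s q
  have hU' : (U.withStart U.start).IsUnambiguous := hU
  refine (hU'.evalFrom x).mono (Set.singleton_subset_iff.2 ?_)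
  exact U.evalFrom_mono (Set.singleton_subset_iff.2 hs) x hx

lemma IsUnambiguous.eq_of_mem_step (h : (U.withStart R).IsUnambiguous)
    (hq : (U.withStart {q}).language.Nonempty) (hp : p ∈ R) (hp' : p' ∈ R)
    (hstep : q ∈ U.step p a) (hstep' : q ∈ U.step p' a) : p = p' := by
  obtain ⟨w, ρ, hρ⟩ := hq
  obtain rfl : ρ 0 = q := hρ.1.1
  exact congrFun (h _ _ _ ((hρ.withStart hstep).consSeq hp) ((hρ.withStart hstep').consSeq hp')) 0

lemma IsUnambiguous.sum_indicator_mul_indicator [Fintype Q]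
    (h : (U.withStart R).IsUnambiguous) (hq : (U.withStart {q}).language.Nonempty) (a : A) :
    ∑ p, R.indicator 1 p * (U.step p a).indicator 1 q =
      (U.stepSet R a).indicator (1 : Q → ℝ) q := by
  by_cases hmem : q ∈ U.stepSet R a
  · obtain ⟨p, hp, hstep⟩ := NFA.mem_stepSet.1 hmem
    rw [sum_eq_single p (fun p' _ hne ↦ ?_) (by simp)]
    · simp [hp, hstep, hmem]
    · by_contra hmul
      have hp' := Set.mem_of_indicator_ne_zero (left_ne_zero_of_mul hmul)
      have hstep' := Set.mem_of_indicator_ne_zero (right_ne_zero_of_mul hmul)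
      exact hne (h.eq_of_mem_step hq hp' hp hstep' hstep)
  · rw [Set.indicator_of_notMem hmem]
    refine sum_eq_zero fun p _ ↦ ?_
    by_contra hmul
    exact hmem (NFA.mem_stepSet.2 ⟨p, Set.mem_of_indicator_ne_zero (left_ne_zero_of_mul hmul),
      Set.mem_of_indicator_ne_zero (right_ne_zero_of_mul hmul)⟩)

lemma isUnambiguous_withStart_iff_pairwiseDisjoint
    (h : ∀ q, (U.withStart {q}).IsUnambiguous) : (U.withStart R).IsUnambiguous ↔
      R.PairwiseDisjoint fun q ↦ (U.withStart {q}).language := by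
  constructor
  · exact fun hR p hp q hq hpq ↦ hR.disjoint_language (Set.singleton_subset_iff.2 hp)
      (Set.singleton_subset_iff.2 hq) (Set.disjoint_singleton.2 hpq)
  · intro hR w ρ ρ' hρ hρ'
    have h0 : ρ 0 = ρ' 0 := hR.elim_set hρ.1.1 hρ'.1.1 w ⟨ρ, hρ.withStart rfl⟩
      ⟨ρ', hρ'.withStart rfl⟩
    exact h (ρ 0) w ρ ρ' (hρ.withStart rfl) (hρ'.withStart h0.symm)

end Unambiguous

section Nonblocking

variable {A Q : Type*} {U : NBA A Q} {R S : Set Q} {w : ℕ → A}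

/-- Every finite word can be read from some state in `R`; this is the right-hand side of the
characterisation of pure cuts, for an arbitrary set of states. -/
def IsNonblocking (U : NBA A Q) (R : Set Q) : Prop :=
  ∀ y, (U.evalFrom R y).Nonempty

lemma IsNonblocking.mono (h : U.IsNonblocking R) (hRS : R ⊆ S) : U.IsNonblocking S :=
  fun y ↦ (h y).mono (U.evalFrom_mono hRS y)

lemma IsNonblocking.evalFrom (h : U.IsNonblocking R) (x : List A) :
    U.IsNonblocking (U.evalFrom R x) :=
  fun y ↦ U.evalFrom_append R x y ▸ h (x ++ y)

lemma exists_partial_run {n : ℕ} (h : (U.evalFrom R (List.ofFn fun i : Fin n ↦ w i)).Nonempty) :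
    ∃ ρ : ℕ → Q, ρ 0 ∈ R ∧ ∀ i < n, ρ (i + 1) ∈ U.step (ρ i) (w i) := by
  induction n generalizing R w with
  | zero =>
    obtain ⟨q, hq⟩ := h
    exact ⟨fun _ ↦ q, by simpa using hq, by simp⟩
  | succ n ih =>
    rw [List.ofFn_succ, NFA.evalFrom_cons] at h
    obtain ⟨ρ, hρ0, hρ⟩ := ih (w := fun n ↦ w (n + 1)) h
    obtain ⟨q, hq, hstep⟩ := NFA.mem_stepSet.1 hρ0
    refine ⟨consSeq q ρ, hq, ?_⟩
    rintro (_ | i) hi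
    exacts [hstep, hρ i (Nat.lt_of_succ_lt_succ hi)]

lemma IsNonblocking.exists_isRun [Finite Q] (h : U.IsNonblocking R) (w : ℕ → A) :
    ∃ ρ, (U.withStart R).IsRun w ρ := by
  let _ : TopologicalSpace Q := ⊥
  have : DiscreteTopology Q := ⟨rfl⟩
  let K (n : ℕ) : Set (ℕ → Q) := {ρ | ρ 0 ∈ R ∧ ∀ i < n, ρ (i + 1) ∈ U.step (ρ i) (w i)}
  have hclosed (n : ℕ) : IsClosed (K n) := by
    have hstep (i : ℕ) : IsClosed {ρ : ℕ → Q | ρ (i + 1) ∈ U.step (ρ i) (w i)} :=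
      (isClosed_discrete {p : Q × Q | p.2 ∈ U.step p.1 (w i)}).preimage
        (f := fun ρ : ℕ → Q ↦ (ρ i, ρ (i + 1))) (by fun_prop)
    have hstart : IsClosed {ρ : ℕ → Q | ρ 0 ∈ R} := (isClosed_discrete R).preimage (by fun_prop)
    simpa only [K, Set.ofPred_and, Set.ofPred_forall] using
      hstart.inter (isClosed_iInter fun i ↦ isClosed_iInter fun _ ↦ hstep i)
  obtain ⟨ρ, hρ⟩ := IsCompact.nonempty_iInter_of_sequence_nonempty_isCompact_isClosed K
    (fun n ρ hρ ↦ ⟨hρ.1, fun i hi ↦ hρ.2 i (hi.trans n.lt_succ_self)⟩)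
    (fun n ↦ exists_partial_run (h _)) (hclosed 0).isCompact hclosed
  rw [Set.mem_iInter] at hρ
  exact ⟨ρ, (hρ 0).1, fun i ↦ (hρ (i + 1)).2 i i.lt_succ_self⟩

end Nonblocking

section NonemptyLanguage

variable {A Q : Type*} {U : NBA A Q}

lemma IsStronglyConnected.exists_ne_nil_mem_evalFrom (hsc : U.IsStronglyConnected) {p' q' : Q}
    {a : A} (hstep : q' ∈ U.step p' a) (p q : Q) : ∃ x ≠ [], q ∈ U.evalFrom {p} x := by
  obtain ⟨x, hx⟩ := hsc p p'
  obtain ⟨y, hy⟩ := hsc q' q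
  refine ⟨x ++ a :: y, by simp, ?_⟩
  rw [NFA.evalFrom_append, NFA.evalFrom_cons]
  exact U.evalFrom_mono (Set.singleton_subset_iff.2 (NFA.mem_stepSet.2 ⟨p', hx, hstep⟩)) y hy

lemma IsStronglyConnected.exists_mem_step (hsc : U.IsStronglyConnected) {p' q' : Q}
    {a : A} (hstep : q' ∈ U.step p' a) (q : Q) : ∃ p a, q ∈ U.step p a := by
  obtain ⟨x, hx, hq⟩ := hsc.exists_ne_nil_mem_evalFrom hstep q q
  rw [← List.dropLast_append_getLast hx, NFA.evalFrom_append, NFA.evalFrom_singleton] at hq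
  obtain ⟨p, -, hp⟩ := NFA.mem_stepSet.1 hq
  exact ⟨p, _, hp⟩

lemma exists_rank (h : ∀ q, ∃ x ≠ [], x ∈ U.acceptsFrom {q}) :
    ∃ d : Q → ℕ, ∀ q, ∃ a, ∃ q' ∈ U.step q a, q' ∈ U.accept ∨ d q' < d q := by
  let lengths (q : Q) : Set ℕ := {n | ∃ x ≠ [], x ∈ U.acceptsFrom {q} ∧ x.length = n}
  refine ⟨fun q ↦ sInf (lengths q), fun q ↦ ?_⟩
  have hne : (lengths q).Nonempty := let ⟨x, hx, hacc⟩ := h q; ⟨x.length, x, hx, hacc, rfl⟩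
  obtain ⟨x, hx, hacc, hlen⟩ := Nat.sInf_mem hne
  obtain ⟨a, y, rfl⟩ := List.exists_cons_of_ne_nil hx
  obtain ⟨f, hf, hmem⟩ := NFA.mem_acceptsFrom.1 (U.cons_mem_acceptsFrom.1 hacc)
  obtain ⟨q', hq', hy⟩ := NFA.mem_evalFrom_iff_exists.1 hmem
  refine ⟨a, q', by simpa using hq', ?_⟩
  rcases eq_or_ne y [] with rfl | hy0
  · left
    obtain rfl : f = q' := hy
    exact hf
  · right
    have hle : sInf (lengths q') ≤ y.length :=
      Nat.sInf_le ⟨y, hy0, NFA.mem_acceptsFrom.2 ⟨f, hf, hy⟩, rfl⟩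
    calc sInf (lengths q') ≤ y.length := hle
      _ < (a :: y).length := Nat.lt_succ_self _
      _ = sInf (lengths q) := hlen

lemma language_withStart_singleton_nonempty (h : ∀ q, ∃ x ≠ [], x ∈ U.acceptsFrom {q}) (q : Q) :
    (U.withStart {q}).language.Nonempty := by
  obtain ⟨d, hd⟩ := exists_rank h
  choose letter next hstep hrank using hd
  let ρ (n : ℕ) : Q := next^[n] q
  have hsucc (n : ℕ) : ρ (n + 1) = next (ρ n) := Function.iterate_succ_apply' next n q
  refine ⟨fun n ↦ letter (ρ n), ρ, ⟨rfl, fun n ↦ hsucc n ▸ hstep (ρ n)⟩, ?_⟩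
  refine Nat.frequently_atTop_iff_infinite.1 fun hfin ↦ ?_
  obtain ⟨N, hN⟩ := eventually_atTop.1 hfin
  refine not_strictAnti_of_wellFoundedLT (fun n ↦ d (ρ (N + n)))
    (strictAnti_nat_of_succ_lt fun n ↦ ?_)
  have hnot : ρ (N + n + 1) ∉ U.accept := hN _ (by omega)
  rw [hsucc] at hnot
  rw [← add_assoc, hsucc]
  exact (hrank _).resolve_left hnot

lemma IsStronglyConnected.language_nonempty (hsc : U.IsStronglyConnected)
    (haccept : U.accept.Nonempty) {p q : Q} {a : A} (hstep : q ∈ U.step p a) (r : Q) :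
    (U.withStart {r}).language.Nonempty := by
  refine language_withStart_singleton_nonempty (fun r ↦ ?_) r
  obtain ⟨f, hf⟩ := haccept
  obtain ⟨x, hx, hfx⟩ := hsc.exists_ne_nil_mem_evalFrom hstep r f
  exact ⟨x, hx, NFA.mem_acceptsFrom.2 ⟨f, hf, hfx⟩⟩

end NonemptyLanguage

section TransitionMatrix

variable {A Q : Type*} [Fintype A] {U : NBA A Q} {R : Set Q} {p q : Q} {a : A}

/-- The average over all letters of the 0-1 transition matrices of `U`. The entries of its powers
are the expected numbers of paths labelled by a random word. -/
noncomputable def transitionMatrix (U : NBA A Q) : Matrix Q Q ℝ :=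
  of fun p q ↦ (Fintype.card A : ℝ)⁻¹ * ∑ a, (U.step p a).indicator 1 q

lemma transitionMatrix_nonneg (U : NBA A Q) (p q : Q) : 0 ≤ U.transitionMatrix p q :=
  mul_nonneg (by positivity) (sum_nonneg fun _ _ ↦ Set.indicator_nonneg (fun _ _ ↦ zero_le_one) _)

lemma transitionMatrix_pos (h : q ∈ U.step p a) : 0 < U.transitionMatrix p q := by
  have : Nonempty A := ⟨a⟩
  refine mul_pos (by positivity) (sum_pos' (fun _ _ ↦ ?_) ⟨a, mem_univ a, ?_⟩)
  · exact Set.indicator_nonneg (fun _ _ ↦ zero_le_one) _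
  · simp [h]

lemma transitionMatrix_pow_length_pos [Fintype Q] [DecidableEq Q] {x : List A}
    (h : q ∈ U.evalFrom {p} x) :
    0 < (U.transitionMatrix ^ x.length) p q := by
  induction x generalizing p with
  | nil =>
    obtain rfl : q = p := h
    simp
  | cons a x ih =>
    rw [NFA.evalFrom_cons, NFA.stepSet_singleton] at h
    obtain ⟨r, hr, hq⟩ := NFA.mem_evalFrom_iff_exists.1 h
    rw [List.length_cons, pow_succ']
    refine (mul_pos (transitionMatrix_pos hr) (ih hq)).trans_le ?_
    exact mul_le_mulVec_apply (v := fun r ↦ (U.transitionMatrix ^ x.length) r q)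
      U.transitionMatrix_nonneg
      (fun r ↦ pow_apply_nonneg U.transitionMatrix_nonneg x.length r q) p r

lemma IsStronglyConnected.isIrreducible_transitionMatrix [Finite Q]
    (hsc : U.IsStronglyConnected) (hstep : q ∈ U.step p a) : U.transitionMatrix.IsIrreducible := by
  classical
  have := Fintype.ofFinite Q
  refine (isIrreducible_iff_exists_pow_pos U.transitionMatrix_nonneg).2 fun r s ↦ ?_
  obtain ⟨x, hx, hs⟩ := hsc.exists_ne_nil_mem_evalFrom hstep r s
  exact ⟨x.length, List.length_pos_of_ne_nil hx, transitionMatrix_pow_length_pos hs⟩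

variable [Fintype Q]

lemma IsUnambiguous.indicator_vecMul_transitionMatrix (h : (U.withStart R).IsUnambiguous)
    (hne : ∀ q, (U.withStart {q}).language.Nonempty) :
    R.indicator 1 ᵥ* U.transitionMatrix =
      (Fintype.card A : ℝ)⁻¹ • ∑ a, (U.stepSet R a).indicator 1 := by
  funext q
  simp only [vecMul, dotProduct, transitionMatrix, of_apply, Pi.smul_apply, Finset.sum_apply,
    smul_eq_mul, ← h.sum_indicator_mul_indicator (hne q), mul_left_comm _ (Fintype.card A : ℝ)⁻¹,
    mul_sum]
  exact sum_comm

variable [DecidableEq Q]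

lemma IsUnambiguous.indicator_vecMul_pow_le_one [Nonempty A] (h : (U.withStart R).IsUnambiguous)
    (hne : ∀ q, (U.withStart {q}).language.Nonempty) (n : ℕ) (q : Q) :
    (R.indicator 1 ᵥ* U.transitionMatrix ^ n) q ≤ 1 := by
  induction n generalizing R with
  | zero =>
    rw [pow_zero, vecMul_one]
    exact Set.indicator_le_self' (fun _ _ ↦ zero_le_one) q
  | succ n ih =>
    rw [pow_succ', ← vecMul_vecMul, h.indicator_vecMul_transitionMatrix hne, smul_vecMul,
      sum_vecMul, Pi.smul_apply, Finset.sum_apply, smul_eq_mul,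
      inv_mul_le_one₀ (by exact_mod_cast Fintype.card_pos)]
    calc ∑ a, ((U.stepSet R a).indicator 1 ᵥ* U.transitionMatrix ^ n) q
        ≤ ∑ _a : A, (1 : ℝ) := sum_le_sum fun a _ ↦ ih (h.stepSet a)
      _ = Fintype.card A := by simp

lemma transitionMatrix_pow_le_one [Nonempty A] (h : ∀ q, (U.withStart {q}).IsUnambiguous)
    (hne : ∀ q, (U.withStart {q}).language.Nonempty) (n : ℕ) (p q : Q) :
    (U.transitionMatrix ^ n) p q ≤ 1 := by
  have hrow := (h p).indicator_vecMul_pow_le_one hne n q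
  rwa [Set.indicator_singleton, Pi.one_apply, single_one_vecMul] at hrow

end TransitionMatrix

section AvoidAccept

variable {A Q : Type*} {U : NBA A Q} {p q : Q} {a : A}

/-- The infinite words that have a run, accepting or not. -/
def runWords (U : NBA A Q) : Set (ℕ → A) :=
  {w | ∃ ρ, U.IsRun w ρ}

/-- The automaton `U` without the transitions into accepting states. -/
def avoidAccept (U : NBA A Q) : NBA A Q where
  step p a := U.step p a \ U.accept
  start := U.start
  accept := U.accept

lemma tail_mem_runWords {w : ℕ → A} (h : w ∈ (U.withStart {q}).runWords) :
    (fun n ↦ w (n + 1)) ∈ ⋃ p ∈ U.step q (w 0), (U.withStart {p}).runWords := by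
  obtain ⟨ρ, h0, hρ⟩ := h
  obtain rfl : ρ 0 = q := h0
  exact Set.mem_biUnion (hρ 0) ⟨fun n ↦ ρ (n + 1), rfl, fun n ↦ hρ (n + 1)⟩

lemma exists_shift_mem_runWords_avoidAccept {R : Set Q} {w : ℕ → A} {ρ : ℕ → Q}
    (hρ : (U.withStart R).IsRun w ρ) (hw : w ∉ (U.withStart R).language) :
    ∃ N, (fun n ↦ w (n + N)) ∈ (U.avoidAccept.withStart {ρ N}).runWords := by
  have hfin : ¬ ∃ᶠ n in atTop, ρ n ∈ U.accept :=
    fun h ↦ hw ⟨ρ, hρ, Nat.frequently_atTop_iff_infinite.1 h⟩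
  obtain ⟨N, hN⟩ := eventually_atTop.1 (not_frequently.1 hfin)
  refine ⟨N, fun n ↦ ρ (n + N), by simp [withStart], fun n ↦ ⟨?_, hN _ (by omega)⟩⟩
  simpa only [withStart, add_right_comm n 1 N] using hρ.2 (n + N)

variable [Fintype A]

lemma transitionMatrix_avoidAccept_le (U : NBA A Q) (p q : Q) :
    U.avoidAccept.transitionMatrix p q ≤ U.transitionMatrix p q := by
  refine mul_le_mul_of_nonneg_left (sum_le_sum fun a _ ↦ ?_) (by positivity)
  exact Set.indicator_le_indicator_of_subset Set.sdiff_subset (fun _ ↦ zero_le_one) q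

lemma transitionMatrix_avoidAccept_eq_zero (hq : q ∈ U.accept) (p : Q) :
    U.avoidAccept.transitionMatrix p q = 0 := by
  simp [transitionMatrix, avoidAccept, hq]

variable [Nonempty A] [MeasurableSpace A] [MeasurableSingletonClass A]

lemma real_runWords_le_mulVec [Fintype Q] (U : NBA A Q) :
    (fun q ↦ (uniformWordMeasure A).real (U.withStart {q}).runWords) ≤
      U.transitionMatrix *ᵥ fun q ↦ (uniformWordMeasure A).real (U.withStart {q}).runWords := by
  classical
  intro q
  set v : Q → ℝ := fun q ↦ (uniformWordMeasure A).real (U.withStart {q}).runWords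
  have hunion (a : A) :
      (uniformWordMeasure A).real (⋃ p ∈ U.step q a, (U.withStart {p}).runWords) ≤
        ∑ p, (U.step q a).indicator 1 p * v p := by
    have h := measureReal_biUnion_finset_le (μ := uniformWordMeasure A) (U.step q a).toFinset
      fun p ↦ (U.withStart {p}).runWords
    simpa [Set.indicator_apply, ← sum_filter, Set.filter_mem_univ_eq_toFinset, v] using h
  calc v q ≤ (Fintype.card A : ℝ)⁻¹ * ∑ a, ∑ p, (U.step q a).indicator 1 p * v p :=
        (uniformWordMeasure_real_le_of_tail_mem fun w hw ↦ tail_mem_runWords hw).trans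
          (mul_le_mul_of_nonneg_left (sum_le_sum fun a _ ↦ hunion a) (by positivity))
    _ = (U.transitionMatrix *ᵥ v) q := by
        simp only [mulVec, dotProduct, transitionMatrix, of_apply, mul_assoc, sum_mul, mul_sum]
        exact sum_comm

end AvoidAccept

section LanguageMeasure

variable {A Q : Type*} [Fintype A] [Nonempty A] [MeasurableSpace A] {U : NBA A Q}
  {R : Set Q}

lemma isAlmostUniversal_of_ae (h : ∀ᵐ w ∂uniformWordMeasure A, w ∈ U.language) :
    U.IsAlmostUniversal :=
  (measure_congr (eventuallyEq_univ.2 h)).trans measure_univ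

lemma exists_isPositive_withStart_singleton [Finite Q] (h : (U.withStart R).IsPositive) :
    ∃ q, (U.withStart {q}).IsPositive := by
  by_contra! hnull
  refine h.ne' ?_
  rw [language_withStart_eq_biUnion, measure_biUnion_null_iff R.to_countable]
  exact fun q _ ↦ nonpos_iff_eq_zero.1 (not_lt.1 (hnull q))

lemma IsCut.isPositive (hR : U.IsCut R) : (U.withStart R).IsPositive :=
  zero_lt_one.trans_eq hR.2.symm

variable [MeasurableSingletonClass A] [Finite Q]

lemma IsStronglyConnected.measure_runWords_avoidAccept_eq_zero (hsc : U.IsStronglyConnected)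
    (hsing : ∀ q, (U.withStart {q}).IsUnambiguous) (haccept : U.accept.Nonempty) {p r : Q} {a : A}
    (hstep : r ∈ U.step p a) (q : Q) :
    uniformWordMeasure A (U.avoidAccept.withStart {q}).runWords = 0 := by
  classical
  have := Fintype.ofFinite Q
  obtain ⟨f, hf⟩ := haccept
  have hne := hsc.language_nonempty ⟨f, hf⟩ hstep
  obtain ⟨p', a', hpred⟩ : ∃ p' a', f ∈ U.step p' a' := hsc.exists_mem_step hstep f
  have hlt : U.avoidAccept.transitionMatrix p' f < U.transitionMatrix p' f := by
    rw [transitionMatrix_avoidAccept_eq_zero hf]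
    exact transitionMatrix_pos hpred
  have hzero := eq_zero_of_le_mulVec_of_lt (hsc.isIrreducible_transitionMatrix hstep)
    (transitionMatrix_pow_le_one hsing hne) U.transitionMatrix_avoidAccept_le hlt
    (fun _ ↦ measureReal_nonneg) U.avoidAccept.real_runWords_le_mulVec
  exact (measureReal_eq_zero_iff).1 (congrFun hzero q)

lemma IsNonblocking.ae_mem_language (hR : U.IsNonblocking R)
    (hsing : ∀ q, (U.withStart {q}).IsUnambiguous) (hsc : U.IsStronglyConnected)
    (haccept : U.accept.Nonempty) : ∀ᵐ w ∂uniformWordMeasure A, w ∈ (U.withStart R).language := by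
  obtain ⟨a⟩ := ‹Nonempty A›
  obtain ⟨ρ, hρ⟩ := hR.exists_isRun fun _ ↦ a
  have hnull (N : ℕ) (q : Q) : ∀ᵐ w ∂uniformWordMeasure A,
      (fun n ↦ w (n + N)) ∉ (U.avoidAccept.withStart {q}).runWords := by
    refine (measurePreserving_drop N).quasiMeasurePreserving.ae (p := (· ∉ _)) ?_
    exact measure_eq_zero_iff_ae_notMem.1
      (hsc.measure_runWords_avoidAccept_eq_zero hsing haccept (hρ.2 0) q)
  filter_upwards [ae_all_iff.2 fun N ↦ ae_all_iff.2 (hnull N)] with w hw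
  obtain ⟨σ, hσ⟩ := hR.exists_isRun w
  by_contra hnot
  obtain ⟨N, hN⟩ := exists_shift_mem_runWords_avoidAccept hσ hnot
  exact hw N (σ N) hN

end LanguageMeasure

section MaximumPrinciple

variable {A Q : Type*} [Fintype A] [Nonempty A] [MeasurableSpace A] [MeasurableSingletonClass A]
  {U : NBA A Q} {R : Set Q}

lemma real_language_le_average (U : NBA A Q) (R : Set Q) :
    (uniformWordMeasure A).real (U.withStart R).language ≤ (Fintype.card A : ℝ)⁻¹ *
      ∑ a, (uniformWordMeasure A).real (U.withStart (U.stepSet R a)).language :=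
  uniformWordMeasure_real_le_of_tail_mem fun _ ↦ mem_language_withStart_iff_tail.1

lemma real_language_stepSet_eq_of_forall_le
    (h : ∀ a, (uniformWordMeasure A).real (U.withStart (U.stepSet R a)).language ≤
      (uniformWordMeasure A).real (U.withStart R).language) (a : A) :
    (uniformWordMeasure A).real (U.withStart (U.stepSet R a)).language =
      (uniformWordMeasure A).real (U.withStart R).language := by
  refine (h a).eq_of_not_lt fun hlt ↦ (U.real_language_le_average R).not_gt ?_
  rw [inv_mul_lt_iff₀ (by exact_mod_cast Fintype.card_pos)]
  calc ∑ b, (uniformWordMeasure A).real (U.withStart (U.stepSet R b)).language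
      < ∑ _b : A, (uniformWordMeasure A).real (U.withStart R).language :=
        sum_lt_sum (fun b _ ↦ h b) ⟨a, mem_univ a, hlt⟩
    _ = Fintype.card A * (uniformWordMeasure A).real (U.withStart R).language := by simp

lemma real_language_evalFrom_eq_of_forall_le
    (h : ∀ x, (uniformWordMeasure A).real (U.withStart (U.evalFrom R x)).language ≤
      (uniformWordMeasure A).real (U.withStart R).language) (x : List A) :
    (uniformWordMeasure A).real (U.withStart (U.evalFrom R x)).language =
      (uniformWordMeasure A).real (U.withStart R).language := by
  induction x generalizing R with
  | nil => rfl
  | cons a x ih =>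
    have hstep := real_language_stepSet_eq_of_forall_le (fun b ↦ h [b]) a
    exact (ih (R := U.stepSet R a) fun y ↦ (h (a :: y)).trans_eq hstep.symm).trans hstep

lemma isNonblocking_of_forall_real_language_le
    (hpos : 0 < (uniformWordMeasure A).real (U.withStart R).language)
    (h : ∀ x, (uniformWordMeasure A).real (U.withStart (U.evalFrom R x)).language ≤
      (uniformWordMeasure A).real (U.withStart R).language) : U.IsNonblocking R := by
  intro x
  rw [← real_language_evalFrom_eq_of_forall_le h x] at hpos
  obtain ⟨w, ρ, hρ⟩ := nonempty_of_measureReal_ne_zero hpos.ne'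
  exact ⟨ρ 0, hρ.1.1⟩

lemma isNonblocking_of_isAlmostUniversal (h : (U.withStart R).IsAlmostUniversal) :
    U.IsNonblocking R := by
  have hone : (uniformWordMeasure A).real (U.withStart R).language = 1 := by
    simpa [measureReal_def] using congrArg ENNReal.toReal h
  refine isNonblocking_of_forall_real_language_le (hone ▸ one_pos) fun x ↦ ?_
  exact measureReal_le_one.trans_eq hone.symm

lemma exists_isNonblocking_evalFrom [Finite Q] (h : (U.withStart R).IsPositive) :
    ∃ x, U.IsNonblocking (U.evalFrom R x) := by
  obtain ⟨_, ⟨x, rfl⟩, hmax⟩ := Set.exists_max_image (Set.range (U.evalFrom R))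
    (fun S ↦ (uniformWordMeasure A).real (U.withStart S).language) (Set.toFinite _)
    ⟨_, [], rfl⟩
  refine ⟨x, isNonblocking_of_forall_real_language_le ?_ fun y ↦ ?_⟩
  · exact (ENNReal.toReal_pos h.ne' (measure_ne_top _ _)).trans_le (hmax R ⟨[], rfl⟩)
  · exact hmax _ ⟨x ++ y, U.evalFrom_append R x y⟩

lemma IsStronglyConnected.exists_isNonblocking_evalFrom_singleton [Finite Q]
    (hsc : U.IsStronglyConnected) (h : (U.withStart R).IsPositive) (q : Q) :
    ∃ x, U.IsNonblocking (U.evalFrom {q} x) := by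
  obtain ⟨p, hp⟩ := exists_isPositive_withStart_singleton h
  obtain ⟨x, hx⟩ := hsc q p
  obtain ⟨y, hy⟩ := exists_isNonblocking_evalFrom hp
  refine ⟨x ++ y, hy.mono ?_⟩
  rw [NFA.evalFrom_append]
  exact U.evalFrom_mono (Set.singleton_subset_iff.2 hx) y

end MaximumPrinciple

section Cuts

variable {A Q : Type*} [Finite Q] {U : NBA A Q} {R S C C' D : Set Q}

lemma IsNonblocking.not_disjoint_language [Finite A] [Nonempty A] (hR : U.IsNonblocking R)
    (hS : U.IsNonblocking S) (hsing : ∀ q, (U.withStart {q}).IsUnambiguous)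
    (hsc : U.IsStronglyConnected) (haccept : U.accept.Nonempty) :
    ¬ Disjoint (U.withStart R).language (U.withStart S).language := by
  have := Fintype.ofFinite A
  let _ : MeasurableSpace A := ⊤
  obtain ⟨w, hw⟩ := ((hR.ae_mem_language hsing hsc haccept).and
    (hS.ae_mem_language hsing hsc haccept)).exists
  exact Set.not_disjoint_iff.2 ⟨w, hw⟩

variable [Fintype A] [Nonempty A] [MeasurableSpace A] [MeasurableSingletonClass A]

lemma isCut_iff (hsing : ∀ q, (U.withStart {q}).IsUnambiguous) (hsc : U.IsStronglyConnected)
    (haccept : U.accept.Nonempty) :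
    U.IsCut C ↔ (U.withStart C).IsUnambiguous ∧ U.IsNonblocking C := by
  rw [isUnambiguous_withStart_iff_pairwiseDisjoint hsing]
  refine and_congr ⟨fun h p hp q hq hpq ↦ ?_, fun h p hp q hq hpq ↦ ?_⟩
    ⟨isNonblocking_of_isAlmostUniversal,
      fun h ↦ isAlmostUniversal_of_ae (h.ae_mem_language hsing hsc haccept)⟩
  · exact (Set.disjoint_iff_inter_eq_empty.2 (h p hp q hq hpq)).symm
  · exact Set.disjoint_iff_inter_eq_empty.1 (h hp hq hpq).symm

lemma isCut_evalFrom_singleton_iff (hsing : ∀ q, (U.withStart {q}).IsUnambiguous)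
    (hsc : U.IsStronglyConnected) (haccept : U.accept.Nonempty) {q : Q} {z : List A} :
    U.IsCut (U.evalFrom {q} z) ↔ U.IsNonblocking (U.evalFrom {q} z) :=
  (isCut_iff hsing hsc haccept).trans (and_iff_right ((hsing q).evalFrom z))

lemma IsCut.exists_isCut_evalFrom_singleton (hC : U.IsCut C)
    (hsing : ∀ q, (U.withStart {q}).IsUnambiguous) (hsc : U.IsStronglyConnected)
    (haccept : U.accept.Nonempty) (q : Q) : ∃ x, U.IsCut (U.evalFrom {q} x) := by
  simp only [isCut_evalFrom_singleton_iff hsing hsc haccept]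
  exact hsc.exists_isNonblocking_evalFrom_singleton hC.isPositive q

lemma IsCut.eq_of_subset (hC : U.IsCut C) (hsing : ∀ q, (U.withStart {q}).IsUnambiguous)
    (hsc : U.IsStronglyConnected) (haccept : U.accept.Nonempty) (hCD : C ⊆ D)
    (hD : (U.withStart D).IsUnambiguous) : C = D := by
  refine hCD.antisymm fun r hr ↦ ?_
  by_contra hrC
  have hdisj : Disjoint (U.withStart C).language (U.withStart {r}).language :=
    hD.disjoint_language hCD (Set.singleton_subset_iff.2 hr) (Set.disjoint_singleton_right.2 hrC)
  obtain ⟨x, hx⟩ := hsc.exists_isNonblocking_evalFrom_singleton hC.isPositive r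
  have hCx : U.IsNonblocking (U.evalFrom C x) :=
    (isNonblocking_of_isAlmostUniversal hC.2).evalFrom x
  exact hCx.not_disjoint_language hx hsing hsc haccept (disjoint_language_evalFrom hdisj x)

lemma IsPureCut.exists_eq_evalFrom_singleton (hC : U.IsPureCut C)
    (hsing : ∀ q, (U.withStart {q}).IsUnambiguous) (hsc : U.IsStronglyConnected)
    (haccept : U.accept.Nonempty) (q : Q) : ∃ z, C = U.evalFrom {q} z := by
  obtain ⟨hcut, p, z, rfl⟩ := hC
  obtain ⟨y, hp⟩ := hsc q p
  refine ⟨y ++ z, hcut.eq_of_subset hsing hsc haccept ?_ ((hsing q).evalFrom _)⟩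
  rw [NFA.evalFrom_append]
  exact U.evalFrom_mono (Set.singleton_subset_iff.2 hp) z

lemma IsCut.exists_eq_evalFrom (hC : U.IsCut C) (hC' : U.IsCut C')
    (hsing : ∀ q, (U.withStart {q}).IsUnambiguous) (hsc : U.IsStronglyConnected)
    (haccept : U.accept.Nonempty) (h : ∀ q, ∃ z, C = U.evalFrom {q} z) :
    ∃ y, C = U.evalFrom C' y := by
  obtain ⟨hunamb, hnonblocking⟩ := (isCut_iff hsing hsc haccept).1 hC'
  obtain ⟨q, hq⟩ : C'.Nonempty := hnonblocking []
  obtain ⟨z, hz⟩ := h q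
  refine ⟨z, hC.eq_of_subset hsing hsc haccept ?_ (hunamb.evalFrom z)⟩
  exact hz.trans_subset (U.evalFrom_mono (Set.singleton_subset_iff.2 hq) z)

end Cuts

end NBA

theorem mainTheorem6 {A Q : Type*} [Fintype A] [Nontrivial A]
    [MeasurableSpace A] [DiscreteMeasurableSpace A] [Finite Q]
    (U : NBA A Q) (hU : U.IsUnambiguous) (hsc : U.IsStronglyConnected)
    (hstart : U.start.Nonempty) (haccept : U.accept.Nonempty) :
    (∀ (q : Q) (z : List A),
      U.IsCut (U.evalFrom {q} z) ↔ ∀ y : List A, U.evalFrom {q} (z ++ y) ≠ ∅) ∧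
    (U.IsPositive → ∀ C : Set Q, U.IsCut C →
      (U.IsPureCut C ↔ ∀ q : Q, ∃ z : List A, C = U.evalFrom {q} z) ∧
      ((∀ q : Q, ∃ z : List A, C = U.evalFrom {q} z) ↔
        ∀ C' : Set Q, U.IsCut C' → ∃ y : List A, C = U.evalFrom C' y)) := by
  have hsing := hU.withStart_singleton hsc hstart
  refine ⟨fun q z ↦ ?_, fun _ C hC ↦ ⟨⟨fun hpure q ↦ ?_, fun h ↦ ?_⟩, ⟨fun h C' hC' ↦ ?_,
    fun h q ↦ ?_⟩⟩⟩
  · rw [NBA.isCut_evalFrom_singleton_iff hsing hsc haccept]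
    simp only [NBA.IsNonblocking, NFA.evalFrom_append, Set.nonempty_iff_ne_empty]
  · exact hpure.exists_eq_evalFrom_singleton hsing hsc haccept q
  · exact ⟨hC, hstart.some, h hstart.some⟩
  · exact hC.exists_eq_evalFrom hC' hsing hsc haccept h
  · obtain ⟨x, hx⟩ := hC.exists_isCut_evalFrom_singleton hsing hsc haccept q
    obtain ⟨y, hy⟩ := h _ hx
    exact ⟨x ++ y, hy.trans (U.evalFrom_append {q} x y).symm⟩
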